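/- Notation. For $A\in M_n(\mathbb C)$ with eigenvalues $\lambda_1(A),\dots,\lambda_n(A)$ (with multiplicity) and $c\in\mathbb R^n$, a $c$-value of $A$ is a number $\sum_{i=1}^n c_i\lambda_{\sigma(i)}(A)$ with $\sigma\in S_n$. The $c$-polynomial is $$p(A;c)(t)=\prod_{b}\Bigl(t-\sum_{i=1}^n b_i\lambda_i(A)\Bigr),$$ where $b$ runs over the distinct rearrangements of $c$; $\deg(A;c)$ is its degree; and $r(A;c)\in\mathbb C[x,y,t]$ is the polynomial $r(A;c)(x,y,t)=p(xA+yA^*;c)(t)$. For $\theta\in\mathbb R$ let $H_\theta(A)=\tfrac12(e^{i\theta}A+e^{-i\theta}A^*)$, with eigenvalues $\lambda_1(H_\theta(A))\ge\dots\ge\lambda_n(H_\theta(A))$. The weighted numerical range and the $c$-numerical range are $$W(A;c)=\bigcap_{\theta}\Bigl\{v\in\mathbb C:\operatorname{Re}e^{i\theta}v\le\sum_{j=1}^n c_j\lambda_j(H_\theta(A))\Bigr\},\qquad W_c(A)=\Bigl\{\sum_{j=1}^n c_jx_j^*Ax_j: x_1,\dots,x_n\in\mathbb C^n\text{ orthonormal}\Bigr\}.$$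 A supporting line of a set $S\subseteq\mathbb C$ is a real line that meets $S$ and has $S$ in one of its two closed half-planes. A point $z\in\partial S$ is a differentiable point of $\partial S$ if near $z$ the boundary is parametrized by a curve $\gamma$ with $\gamma(0)=z$ that is differentiable at $0$ with $\gamma'(0)\neq0$. Theorem. Let $A\in M_n(\mathbb C)$, $B\in M_m(\mathbb C)$, $c\in\mathbb R^n$ and $d\in\mathbb R^m$. Suppose that $W(A;c)$ and $W(B;d)$ have more than $\deg(A;c)\deg(B;d)$ common supporting lines, and that 1. $W(A;c)=W_c(A)$, or each of the common supporting lines touches $\partial W(A;c)$ at a differentiable point; 2. $W(B;d)=W_d(B)$, or each of the common supporting lines touches $\partial W(B;d)$ at a differentiable point. Then there exists a $c$-value of $A$ which is also a $d$-value of $B$. Furthermore, if $r(A;c)$ is irreducible in $\mathbb C[x,y,t]$, then all the $c$-values of $A$ are $d$-values of $B$. -/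

import Mathlib

open scoped Topology

namespace WeightedRange

/-! ### Eigenvalues, `c`-values and the `c`-polynomial -/

/-- A complex `n × n` matrix has exactly `n` eigenvalues, counted with multiplicity. -/
theorem exists_eigenvalues {n : ℕ} (A : Matrix (Fin n) (Fin n) ℂ) :
    ∃ μ : Fin n → ℂ, Multiset.map μ Finset.univ.val = A.charpoly.roots := by
  have hcard : A.charpoly.roots.card = n := by
    rw [(IsAlgClosed.splits A.charpoly).natDegree_eq_card_roots.symm,
      Matrix.charpoly_natDegree_eq_dim, Fintype.card_fin]
  obtain ⟨l, hl⟩ := Quot.exists_rep A.charpoly.roots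
  have hl' : (l : Multiset ℂ) = A.charpoly.roots := hl
  have hlen : l.length = n := by rw [← hcard, ← hl', Multiset.coe_card]
  subst hlen
  refine ⟨l.get, ?_⟩
  rw [← hl', Fin.univ_val_map, List.ofFn_get]

/-- The eigenvalues `λ₁(A), …, λₙ(A)` of a complex matrix, with multiplicity, in some order. -/
noncomputable def eigenvalues {n : ℕ} (A : Matrix (Fin n) (Fin n) ℂ) : Fin n → ℂ :=
  Classical.choose (exists_eigenvalues A)

theorem eigenvalues_spec {n : ℕ} (A : Matrix (Fin n) (Fin n) ℂ) :
    Multiset.map (eigenvalues A) Finset.univ.val = A.charpoly.roots :=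
  Classical.choose_spec (exists_eigenvalues A)

/-- `z` is a `c`-value of `A`: a sum `∑ᵢ cᵢ λ_{σ(i)}(A)` for a permutation `σ`. The zero entries
of `c` contribute nothing, so this is the same as a sum over the nonzero entries of `c` of
`c_{i_k} λ_{j_k}(A)` with distinct `j_k`. -/
def IsCValue {n : ℕ} (A : Matrix (Fin n) (Fin n) ℂ) (c : Fin n → ℝ) (z : ℂ) : Prop :=
  ∃ σ : Equiv.Perm (Fin n), z = ∑ i, (c i : ℂ) * eigenvalues A (σ i)

/-- The distinct rearrangements of `c`. They index the generically distinct `c`-values. -/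
noncomputable def rearrangements {n : ℕ} (c : Fin n → ℝ) : Finset (Fin n → ℝ) :=
  (Set.finite_range (fun σ : Equiv.Perm (Fin n) => c ∘ σ)).toFinset

/-- The `c`-polynomial `p(A;c)(t)`: the monic polynomial whose roots are the generically distinct
`c`-values, one for each distinct rearrangement of `c`. -/
noncomputable def cPoly {n : ℕ} (A : Matrix (Fin n) (Fin n) ℂ) (c : Fin n → ℝ) : Polynomial ℂ :=
  ∏ b ∈ rearrangements c,
    (Polynomial.X - Polynomial.C (∑ i, (b i : ℂ) * eigenvalues A i))

/-- `deg(A;c)`, the degree of the `c`-polynomial. -/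
noncomputable def cDeg {n : ℕ} (A : Matrix (Fin n) (Fin n) ℂ) (c : Fin n → ℝ) : ℕ :=
  (cPoly A c).natDegree

theorem mem_rearrangements {n : ℕ} {c b : Fin n → ℝ} :
    b ∈ rearrangements c ↔ ∃ σ : Equiv.Perm (Fin n), c ∘ σ = b := by
  simp [rearrangements]

/-- The polynomial `∏ (T - ∑ᵢ bᵢ Xᵢ)`, with `b` ranging over the distinct rearrangements of `c`,
is symmetric in the variables `Xᵢ`. -/
theorem isSymmetric_genericPoly {n : ℕ} (c : Fin n → ℝ) :
    (∏ b ∈ rearrangements c, (MvPolynomial.C (Polynomial.X : Polynomial ℂ) -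
      ∑ i, MvPolynomial.C (Polynomial.C (b i : ℂ)) * MvPolynomial.X i)).IsSymmetric := by
  intro e
  rw [map_prod]
  refine Finset.prod_bij' (fun b _ => b ∘ e.symm) (fun b _ => b ∘ e) ?_ ?_ ?_ ?_ ?_
  · intro b hb
    obtain ⟨σ, rfl⟩ := mem_rearrangements.1 hb
    exact mem_rearrangements.2 ⟨e.symm.trans σ, rfl⟩
  · intro b hb
    obtain ⟨σ, rfl⟩ := mem_rearrangements.1 hb
    exact mem_rearrangements.2 ⟨e.trans σ, rfl⟩
  · intro b _
    ext i; simp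
  · intro b _
    ext i; simp
  · intro b _
    simp only [map_sub, map_sum, map_mul, MvPolynomial.rename_C, MvPolynomial.rename_X]
    congr 1
    refine Fintype.sum_equiv e _ _ fun i => ?_
    simp

/-- `p(xA + yA*;c)(t)` is a polynomial in `x, y, t` (variables `0, 1, 2`). -/
theorem exists_pencilPoly {n : ℕ} (A : Matrix (Fin n) (Fin n) ℂ) (c : Fin n → ℝ) :
    ∃ r : MvPolynomial (Fin 3) ℂ, ∀ x y t : ℂ,
      MvPolynomial.eval ![x, y, t] r = (cPoly (x • A + y • A.conjTranspose) c).eval t := by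
  obtain ⟨Q, hQ⟩ := MvPolynomial.esymmAlgHom_surjective (σ := Fin n) (R := Polynomial ℂ) (n := n)
    (by simp) ⟨_, isSymmetric_genericPoly c⟩
  replace hQ := congrArg Subtype.val hQ
  rw [MvPolynomial.esymmAlgHom_apply] at hQ
  let M : Matrix (Fin n) (Fin n) (MvPolynomial (Fin 3) ℂ) :=
    (MvPolynomial.X 0 : MvPolynomial (Fin 3) ℂ) • A.map MvPolynomial.C +
      (MvPolynomial.X 1 : MvPolynomial (Fin 3) ℂ) • A.conjTranspose.map MvPolynomial.C
  refine ⟨MvPolynomial.eval₂ (Polynomial.eval₂RingHom MvPolynomial.C (MvPolynomial.X 2))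
    (fun i : Fin n => (-1) ^ (i.val + 1) * M.charpoly.coeff (n - (i.val + 1))) Q, ?_⟩
  intro x y t
  set N := x • A + y • A.conjTranspose with hN
  have hM : M.map (MvPolynomial.eval ![x, y, t]) = N := by
    ext i j
    simp [M, hN]
  have hcoef : ∀ i : Fin n, MvPolynomial.eval ![x, y, t]
      ((-1) ^ (i.val + 1) * M.charpoly.coeff (n - (i.val + 1))) =
      (Multiset.map (eigenvalues N) Finset.univ.val).esymm (i.val + 1) := by
    intro i
    have h1 : N.charpoly.coeff (n - (i.val + 1)) =
        MvPolynomial.eval ![x, y, t] (M.charpoly.coeff (n - (i.val + 1))) := by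
      rw [← hM, Matrix.charpoly_map, Polynomial.coeff_map]
    have hdeg : N.charpoly.natDegree = n := by
      rw [Matrix.charpoly_natDegree_eq_dim, Fintype.card_fin]
    have h2 := Polynomial.coeff_eq_esymm_roots_of_splits (IsAlgClosed.splits N.charpoly)
      (k := n - (i.val + 1)) (by omega)
    rw [(Matrix.charpoly_monic N).leadingCoeff, one_mul, hdeg,
      show n - (n - (i.val + 1)) = i.val + 1 by omega] at h2
    rw [map_mul, ← h1, h2, eigenvalues_spec, ← mul_assoc, map_pow, map_neg, map_one,
      ← mul_pow]
    simp
  have key := congrArg (MvPolynomial.eval₂Hom (Polynomial.evalRingHom t) (eigenvalues N)) hQ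
  have hR : MvPolynomial.eval₂Hom (Polynomial.evalRingHom t) (eigenvalues N)
      (∏ b ∈ rearrangements c, (MvPolynomial.C (Polynomial.X : Polynomial ℂ) -
        ∑ i, MvPolynomial.C (Polynomial.C (b i : ℂ)) * MvPolynomial.X i)) =
      (cPoly N c).eval t := by
    rw [cPoly, Polynomial.eval_prod, map_prod]
    refine Finset.prod_congr rfl fun b _ => ?_
    simp [Polynomial.eval_finsetSum]
  have hes : ∀ k : ℕ, MvPolynomial.eval₂Hom (Polynomial.evalRingHom t) (eigenvalues N)
      (MvPolynomial.esymm (Fin n) (Polynomial ℂ) k) =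
      (Multiset.map (eigenvalues N) Finset.univ.val).esymm k := by
    intro k
    rw [Finset.esymm_map_val, MvPolynomial.esymm]
    simp
  rw [← hR, ← key]
  rw [← MvPolynomial.coe_eval₂Hom, ← RingHom.comp_apply, MvPolynomial.aeval_def,
    ← MvPolynomial.coe_eval₂Hom, ← RingHom.comp_apply]
  congr 1
  refine MvPolynomial.ringHom_ext ?_ ?_
  · intro p
    simp only [RingHom.comp_apply, MvPolynomial.eval₂Hom_C, MvPolynomial.algebraMap_eq]
    rw [← RingHom.comp_apply]
    congr 1
    refine Polynomial.ringHom_ext ?_ ?_ <;> simp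
  · intro i
    simp only [RingHom.comp_apply, MvPolynomial.eval₂Hom_X']
    rw [hcoef, hes]

/-- `r(A;c)(x,y,t) = p(xA + yA*;c)(t)` as an element of `ℂ[x,y,t]` (variables `0, 1, 2`). -/
noncomputable def pencilPoly {n : ℕ} (A : Matrix (Fin n) (Fin n) ℂ) (c : Fin n → ℝ) :
    MvPolynomial (Fin 3) ℂ :=
  Classical.choose (exists_pencilPoly A c)

theorem eval_pencilPoly {n : ℕ} (A : Matrix (Fin n) (Fin n) ℂ) (c : Fin n → ℝ) (x y t : ℂ) :
    MvPolynomial.eval ![x, y, t] (pencilPoly A c) =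
      (cPoly (x • A + y • A.conjTranspose) c).eval t :=
  Classical.choose_spec (exists_pencilPoly A c) x y t

/-- `r(A;c)` is determined by its values. -/
theorem pencilPoly_unique {n : ℕ} (A : Matrix (Fin n) (Fin n) ℂ) (c : Fin n → ℝ)
    (r : MvPolynomial (Fin 3) ℂ)
    (hr : ∀ x y t : ℂ, MvPolynomial.eval ![x, y, t] r =
      (cPoly (x • A + y • A.conjTranspose) c).eval t) : r = pencilPoly A c := by
  refine MvPolynomial.funext fun v => ?_
  have hv : v = ![v 0, v 1, v 2] := by
    ext i; fin_cases i <;> rfl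
  rw [hv, hr, eval_pencilPoly]

/-! ### Numerical ranges -/

/-- `H_θ(A) = (e^{iθ} A + e^{-iθ} A*) / 2`. -/
noncomputable def rotHerm {n : ℕ} (A : Matrix (Fin n) (Fin n) ℂ) (θ : ℝ) :
    Matrix (Fin n) (Fin n) ℂ :=
  (1 / 2 : ℂ) • (Complex.exp (θ * Complex.I) • A +
    Complex.exp (-(θ * Complex.I)) • A.conjTranspose)

theorem rotHerm_isHermitian {n : ℕ} (A : Matrix (Fin n) (Fin n) ℂ) (θ : ℝ) :
    (rotHerm A θ).IsHermitian := by
  have h : (starRingEnd ℂ) (Complex.exp (θ * Complex.I)) = Complex.exp (-(θ * Complex.I)) := by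
    rw [← Complex.exp_conj]; simp
  have h' : (starRingEnd ℂ) (Complex.exp (-(θ * Complex.I))) = Complex.exp (θ * Complex.I) := by
    rw [← h, Complex.conj_conj]
  unfold rotHerm Matrix.IsHermitian
  ext i j
  simp [Matrix.conjTranspose_apply, h, h']
  ring

/-- `λⱼ(H_θ(A))`, the eigenvalues of the Hermitian matrix `H_θ(A)` in decreasing order
(`eigenvalues₀` is antitone). -/
noncomputable def rotEig {n : ℕ} (A : Matrix (Fin n) (Fin n) ℂ) (θ : ℝ) (j : Fin n) : ℝ :=
  (rotHerm_isHermitian A θ).eigenvalues₀ (Fin.cast (Fintype.card_fin n).symm j)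

theorem rotEig_antitone {n : ℕ} (A : Matrix (Fin n) (Fin n) ℂ) (θ : ℝ) :
    Antitone (rotEig A θ) := fun _ _ h =>
  (rotHerm_isHermitian A θ).eigenvalues₀_antitone h

/-- The weighted numerical range `W(A;c)`. -/
def weightedRange {n : ℕ} (A : Matrix (Fin n) (Fin n) ℂ) (c : Fin n → ℝ) : Set ℂ :=
  {v | ∀ θ : ℝ, (Complex.exp (θ * Complex.I) * v).re ≤ ∑ j, c j * rotEig A θ j}

/-- The `c`-numerical range `W_c(A)`. -/
def cNumericalRange {n : ℕ} (A : Matrix (Fin n) (Fin n) ℂ) (c : Fin n → ℝ) : Set ℂ :=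
  {z | ∃ x : Fin n → EuclideanSpace ℂ (Fin n), Orthonormal ℂ x ∧
    z = ∑ j, (c j : ℂ) * (star (x j).ofLp ⬝ᵥ A.mulVec (x j).ofLp)}

/-! ### Supporting lines and differentiable boundary points -/

/-- `L` is a supporting line of `S`: a real line in `ℂ` (written as `Re (e^{iθ} v) = ρ`) that
meets `S` and has `S` in one of its closed sides. -/
def IsSupportingLine (S L : Set ℂ) : Prop :=
  ∃ θ ρ : ℝ, L = {v | (Complex.exp (θ * Complex.I) * v).re = ρ} ∧
    (∀ v ∈ S, (Complex.exp (θ * Complex.I) * v).re ≤ ρ) ∧ (S ∩ L).Nonempty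

/-- `z` is a differentiable point of the boundary of `S`: near `z` the boundary of `S` is
parametrized by a curve `γ` with `γ(0) = z` that is differentiable at `0` with nonzero
derivative. The last clause says that `γ` carries the neighbourhoods of `0` onto the
neighbourhoods of `z` in `∂S`. -/
def IsDifferentiableBoundaryPoint (S : Set ℂ) (z : ℂ) : Prop :=
  ∃ (γ : ℝ → ℂ) (w : ℂ), γ 0 = z ∧ HasDerivAt γ w 0 ∧ w ≠ 0 ∧
    Filter.map γ (𝓝 0) = 𝓝[frontier S] z

/-- `L` touches the boundary of `S` at a differentiable point. -/
def TouchesDifferentiably (S L : Set ℂ) : Prop :=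
  ∃ z ∈ L ∩ frontier S, IsDifferentiableBoundaryPoint S z

/-- The common supporting lines of two sets. -/
def commonSupportingLines (S T : Set ℂ) : Set (Set ℂ) :=
  {L | IsSupportingLine S L ∧ IsSupportingLine T L}

end WeightedRange

open WeightedRange

namespace WeightedRange

/-! The line `Re (ζ v) = ρ`, with `|ζ| = 1`, has dual point `(ζ/2 : ζ̄/2 : ρ)`. For `ζ = e^{iθ}` the
pencil `xA + yA*` is there `H_θ(A)`, so `r(A;c)` vanishes exactly when `ρ` is a `c`-value of
`H_θ(A)`. Since `c`-values scale with the matrix, `r(A;c)` is a form of degree `deg(A;c)`.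

A supporting line of `W(A;c)` need not be one of the defining constraints, but under either
hypothesis its dual point is a zero of `r(A;c)`. If `W(A;c) = W_c(A)`, Birkhoff's theorem makes `ρ`
an average of permuted eigenvalue sums, none exceeding `ρ`
(`exists_perm_of_isSupporting_cNumericalRange`). At a differentiable point, a limit of constraint
lines supports the range (`exists_dualVanishes_of_mem_frontier`), and the supporting line there is
unique.

Distinct common supporting lines thus give too many common zeros for relatively prime forms
(`card_common_zeros_le`), so `r(A;c)` and `r(B;d)` share a nonconstant factor. As `r(A;c)(1,0,t)` is
monic in `t` of full degree, that factor has a zero `(1,0,t)`, and `t` is a common value. If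
`r(A;c)` is irreducible, it divides `r(B;d)`. -/

/-! ### Weak Bézout theorem for ternary forms -/

/-- The space of ternary forms of degree `k`. -/
abbrev forms (k : ℕ) : Submodule ℂ (MvPolynomial (Fin 3) ℂ) :=
  MvPolynomial.homogeneousSubmodule (Fin 3) ℂ k

open MvPolynomial in
/-- The dimension of the space of ternary forms of degree `k`. -/
theorem finrank_forms (k : ℕ) :
    Module.finrank ℂ (forms k) = (k + 2).choose 2 := by
  have hset : {d : Fin 3 →₀ ℕ | d.degree = k} =
      ((Finset.univ : Finset (Fin 3)).finsuppAntidiag k : Set (Fin 3 →₀ ℕ)) := by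
    ext d
    simp [Finset.mem_finsuppAntidiag, Finsupp.degree_eq_sum]
  have hb := Module.finrank_eq_nat_card_basis
    (basisRestrictSupport ℂ {d : Fin 3 →₀ ℕ | d.degree = k})
  rw [forms, homogeneousSubmodule_eq_finsupp_supported]
  refine hb.trans ?_
  rw [hset, Nat.card_coe_set_eq, Set.ncard_coe_finset, Finset.card_finsuppAntidiag_nat_eq_choose]
  simp only [Finset.card_univ, Fintype.card_fin]
  rw [show 3 + k - 1 = k + 2 by omega, ← Nat.choose_symm (by omega : k ≤ k + 2)]
  congr 1
  omega

instance finite_forms (k : ℕ) :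
    Module.Finite ℂ (forms k) :=
  Module.Finite.iff_fg.2 (MvPolynomial.homogeneousSubmodule_fg _ _ k)

open MvPolynomial in
/-- A cofactor of a form in a form is a form. -/
theorem isHomogeneous_of_mul_left {F q : MvPolynomial (Fin 3) ℂ} {D j : ℕ}
    (hF : F.IsHomogeneous D) (hF0 : F ≠ 0) (h : (F * q).IsHomogeneous (D + j)) :
    q.IsHomogeneous j := by
  let _ := MvPolynomial.gradedAlgebra (σ := Fin 3) (R := ℂ)
  -- The component of `F * q` in degree `D + j` is `F` times the degree `j` component of `q`; it is
  -- all of `F * q`, and `F` cancels.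
  have h1 := DirectSum.coe_decompose_mul_of_left_mem_of_le
    (homogeneousSubmodule (Fin 3) ℂ) (a := F) (b := q) (i := D) (n := D + j) hF (by omega)
  rw [DirectSum.decompose_of_mem_same _ h, Nat.add_sub_cancel_left] at h1
  rw [mul_left_cancel₀ hF0 h1]
  exact (DirectSum.decompose (homogeneousSubmodule (Fin 3) ℂ) q j).2

open MvPolynomial in
/-- Forms of high degree separate distinct points of the affine chart `x = 1`. -/
theorem exists_form_eval_eq {ι : Type*} [Fintype ι] [DecidableEq ι] (s u : ι → ℂ)
    (hinj : Function.Injective fun i => (s i, u i)) (k : ℕ) (hk : Fintype.card ι ≤ k + 1)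
    (i : ι) : ∃ p : MvPolynomial (Fin 3) ℂ, p.IsHomogeneous k ∧
      eval ![1, s i, u i] p ≠ 0 ∧ ∀ j, j ≠ i → eval ![1, s j, u j] p = 0 := by
  have hl : ∀ j, ∃ l : MvPolynomial (Fin 3) ℂ, l.IsHomogeneous 1 ∧
      (j ≠ i → eval ![1, s i, u i] l ≠ 0) ∧ eval ![1, s j, u j] l = 0 := by
    intro j
    by_cases hs : s j = s i
    · refine ⟨X 2 - C (u j) * X 0, (isHomogeneous_X _ _).sub (isHomogeneous_C_mul_X _ _), ?_, ?_⟩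
      · intro hne h
        apply hne
        apply hinj
        simp [sub_eq_zero] at h
        simp [hs, h]
      · simp
    · refine ⟨X 1 - C (s j) * X 0, (isHomogeneous_X _ _).sub (isHomogeneous_C_mul_X _ _), ?_, ?_⟩
      · intro hne h
        simp [sub_eq_zero] at h
        exact hs h.symm
      · simp
  choose l hl1 hl2 hl3 using hl
  have hcard : (Finset.univ.erase i).card ≤ k := by
    rw [Finset.card_erase_of_mem (Finset.mem_univ _), Finset.card_univ]; omega
  -- The power of `X 0` pads the degree to `k` without changing values, since `X 0 = 1` on the
  -- chart.
  refine ⟨X 0 ^ (k - (Finset.univ.erase i).card) * ∏ j ∈ Finset.univ.erase i, l j, ?_, ?_, ?_⟩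
  · have h1 := IsHomogeneous.prod (Finset.univ.erase i) l (fun _ => 1) (fun j _ => hl1 j)
    have h2 := (isHomogeneous_X_pow (R := ℂ) (0 : Fin 3)
      (k - (Finset.univ.erase i).card)).mul h1
    convert h2 using 1
    simp only [Finset.sum_const, smul_eq_mul, mul_one]
    omega
  · rw [map_mul, map_prod]
    refine mul_ne_zero (by simp) (Finset.prod_ne_zero_iff.2 fun j hj => hl2 j (Finset.ne_of_mem_erase hj))
  · intro j hj
    rw [map_mul, map_prod, Finset.prod_eq_zero (i := j) (by simp [hj]) (hl3 j), mul_zero]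

open MvPolynomial in
/-- The weak form of Bézout's theorem in an affine chart: relatively prime ternary forms of
degrees `D` and `E` have at most `D * E` common zeros. -/
theorem card_common_zeros_le {F G : MvPolynomial (Fin 3) ℂ} {D E : ℕ}
    (hF : F.IsHomogeneous D) (hG : G.IsHomogeneous E) (hG0 : G ≠ 0)
    (hrel : IsRelPrime F G)
    {ι : Type*} [Fintype ι] (s u : ι → ℂ)
    (hinj : Function.Injective fun i => (s i, u i))
    (hsF : ∀ i, eval ![1, s i, u i] F = 0) (hsG : ∀ i, eval ![1, s i, u i] G = 0) :
    Fintype.card ι ≤ D * E := by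
  classical
  -- `N` is also used as a degree shift, large enough for evaluation at the `N` points to be
  -- surjective.
  set N := Fintype.card ι with hN
  let ev : forms (D + E + N) →ₗ[ℂ] (ι → ℂ) :=
    LinearMap.pi (fun i => (aeval ![1, s i, u i]).toLinearMap ∘ₗ (forms (D + E + N)).subtype)
  have hev : ∀ p i, ev p i = eval ![1, s i, u i] (p : MvPolynomial (Fin 3) ℂ) := by
    intro p i
    simp [ev, aeval_eq_eval]
  have hsurj : Function.Surjective ev := by
    rw [← LinearMap.range_eq_top, eq_top_iff, ← (Pi.basisFun ℂ ι).span_eq, Submodule.span_le]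
    rintro _ ⟨i, rfl⟩
    obtain ⟨p, hp, hp1, hp2⟩ := exists_form_eval_eq s u hinj (D + E + N) (by omega) i
    refine ⟨(eval ![1, s i, u i] p)⁻¹ • ⟨p, hp⟩, ?_⟩
    ext j
    rw [map_smul, Pi.smul_apply, hev, Pi.basisFun_apply]
    rcases eq_or_ne j i with rfl | hj
    · simp [hp1]
    · simp [hp2 j hj, hj]
  let mF : forms (E + N) →ₗ[ℂ] forms (D + E + N) :=
    ((LinearMap.mulLeft ℂ F) ∘ₗ (forms (E + N)).subtype).codRestrict _ (fun p => by
      have := hF.mul p.2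
      rwa [← add_assoc] at this)
  let mG : forms (D + N) →ₗ[ℂ] forms (D + E + N) :=
    ((LinearMap.mulLeft ℂ G) ∘ₗ (forms (D + N)).subtype).codRestrict _ (fun p => by
      have := hG.mul p.2
      rwa [← add_assoc, add_comm E D] at this)
  let Φ : (forms (E + N) × forms (D + N)) →ₗ[ℂ] forms (D + E + N) := mF.coprod mG
  have hΦ : ∀ p, (Φ p : MvPolynomial (Fin 3) ℂ) = F * p.1 + G * p.2 := by
    intro p
    rfl
  let κ1 : forms N →ₗ[ℂ] forms (E + N) :=
    ((LinearMap.mulLeft ℂ G) ∘ₗ (forms N).subtype).codRestrict _ (fun p => hG.mul p.2)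
  let κ2 : forms N →ₗ[ℂ] forms (D + N) :=
    ((LinearMap.mulLeft ℂ (-F)) ∘ₗ (forms N).subtype).codRestrict _ (fun p => hF.neg.mul p.2)
  let κ : forms N →ₗ[ℂ] (forms (E + N) × forms (D + N)) := κ1.prod κ2
  -- By relative primality, the only relations `F p + G q = 0` are the multiples of `(G, -F)`.
  have hker : LinearMap.ker Φ ≤ LinearMap.range κ := by
    rintro ⟨p, q⟩ hpq
    have h0 : F * (p : MvPolynomial (Fin 3) ℂ) + G * q = 0 := by
      rw [← hΦ (p, q), LinearMap.mem_ker.1 hpq]; rfl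
    have hdvd : G ∣ (p : MvPolynomial (Fin 3) ℂ) :=
      hrel.symm.dvd_of_dvd_mul_left ⟨-q, by linear_combination h0⟩
    obtain ⟨w, hw⟩ := hdvd
    have hwh : w.IsHomogeneous N := isHomogeneous_of_mul_left hG hG0 (hw ▸ p.2)
    refine ⟨⟨w, hwh⟩, ?_⟩
    refine Prod.ext (Subtype.ext ?_) (Subtype.ext ?_)
    · exact hw.symm
    · change -F * w = (q : MvPolynomial (Fin 3) ℂ)
      apply mul_left_cancel₀ hG0
      rw [hw] at h0
      linear_combination -h0
  have hrange : LinearMap.range Φ ≤ LinearMap.ker ev := by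
    rintro _ ⟨p, rfl⟩
    ext i
    rw [hev, hΦ]
    simp [hsF i, hsG i]
  have h1 := LinearMap.finrank_range_add_finrank_ker ev
  have h2 := LinearMap.finrank_range_add_finrank_ker Φ
  have h3 := Submodule.finrank_mono hrange
  have h4 := Submodule.finrank_mono hker
  have h5 := LinearMap.finrank_range_le κ
  rw [LinearMap.range_eq_top.2 hsurj, finrank_top, Module.finrank_fintype_fun_eq_card] at h1
  rw [Module.finrank_prod] at h2
  simp only [finrank_forms] at h1 h2 h5
  have hc : ∀ k : ℕ, ((k + 2).choose 2) * 2 = (k + 2) * (k + 1) := by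
    intro k
    rw [Nat.choose_two_right, Nat.div_mul_cancel (Nat.even_mul_pred_self _).two_dvd]
    rfl
  have c1 := hc (D + E + N)
  have c2 := hc (E + N)
  have c3 := hc (D + N)
  have c4 := hc N
  -- The image of `Φ` lies in the kernel of evaluation, of codimension `N`. Expanding the binomials
  -- leaves `2 * N ≤ 2 * (D * E)`.
  have : 2 * N + (E + N + 2).choose 2 * 2 + (D + N + 2).choose 2 * 2 ≤
    (D + E + N + 2).choose 2 * 2 + (N + 2).choose 2 * 2 := by omega
  rw [c1, c2, c3, c4] at this
  nlinarith

/-! ### Roots of the `c`-polynomial and homogeneity of `r(A;c)` -/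

theorem cDeg_eq_card {n : ℕ} (A : Matrix (Fin n) (Fin n) ℂ) (c : Fin n → ℝ) :
    cDeg A c = (rearrangements c).card := by
  rw [cDeg, cPoly, Polynomial.natDegree_prod_of_monic _ _ fun b _ => Polynomial.monic_X_sub_C _]
  simp only [Polynomial.natDegree_X_sub_C, Finset.sum_const, smul_eq_mul, mul_one]

theorem eval_cPoly_eq_prod {n : ℕ} (A : Matrix (Fin n) (Fin n) ℂ) (c : Fin n → ℝ) (t : ℂ) :
    (cPoly A c).eval t = ∏ b ∈ rearrangements c, (t - ∑ i, (b i : ℂ) * eigenvalues A i) := by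
  simp only [cPoly, Polynomial.eval_prod, Polynomial.eval_sub, Polynomial.eval_X,
    Polynomial.eval_C]

/-- The roots of the `c`-polynomial are the `c`-values. -/
theorem eval_cPoly_eq_zero_iff {n : ℕ} (A : Matrix (Fin n) (Fin n) ℂ) (c : Fin n → ℝ) (t : ℂ) :
    (cPoly A c).eval t = 0 ↔ IsCValue A c t := by
  rw [eval_cPoly_eq_prod, Finset.prod_eq_zero_iff]
  simp only [sub_eq_zero, mem_rearrangements]
  constructor
  · rintro ⟨_, ⟨σ, rfl⟩, h⟩
    refine ⟨σ.symm, h.trans ?_⟩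
    refine Fintype.sum_equiv σ _ _ fun i => ?_
    simp
  · rintro ⟨σ, h⟩
    refine ⟨_, ⟨σ.symm, rfl⟩, h.trans ?_⟩
    refine Fintype.sum_equiv σ _ _ fun i => ?_
    simp

/-- Two enumerations of the same multiset differ by a permutation. -/
theorem exists_perm_of_map_univ_eq {n : ℕ} {α : Type*} {f g : Fin n → α}
    (h : Multiset.map f Finset.univ.val = Multiset.map g Finset.univ.val) :
    ∃ σ : Equiv.Perm (Fin n), f = g ∘ σ := by
  classical
  -- Equal multiplicities make the fibres of `f` and `g` over each value equinumerous; fibrewise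
  -- bijections glue to a permutation.
  have hcard : ∀ a, Nonempty ({i // f i = a} ≃ {i // g i = a}) := by
    intro a
    refine ⟨Fintype.equivOfCardEq ?_⟩
    have hcount := congrArg (Multiset.count a) h
    rw [Multiset.count_map, Multiset.count_map] at hcount
    rw [Fintype.card_subtype, Fintype.card_subtype]
    simp only [eq_comm (a := a)] at hcount
    exact hcount
  let e := fun a => (hcard a).some
  refine ⟨(Equiv.sigmaFiberEquiv f).symm.trans
    ((Equiv.sigmaCongrRight fun a => (e a)).trans (Equiv.sigmaFiberEquiv g)), ?_⟩
  ext i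
  exact (e (f i) ⟨i, rfl⟩).2.symm

theorem exists_perm_eigenvalues {n : ℕ} {A : Matrix (Fin n) (Fin n) ℂ} {f : Fin n → ℂ}
    (h : A.charpoly.roots = Multiset.map f Finset.univ.val) :
    ∃ σ : Equiv.Perm (Fin n), f = eigenvalues A ∘ σ :=
  exists_perm_of_map_univ_eq (h.symm.trans (eigenvalues_spec A).symm)

/-- The enumeration `eigenvalues` is chosen separately for each matrix, so scaling can be compared
only up to a permutation. -/
theorem exists_perm_eigenvalues_smul {n : ℕ} (A : Matrix (Fin n) (Fin n) ℂ) (a : ℂ) :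
    ∃ σ : Equiv.Perm (Fin n), (fun i => a * eigenvalues A i) = eigenvalues (a • A) ∘ σ := by
  apply exists_perm_eigenvalues
  have hA : A.charpoly = ∏ i, (Polynomial.X - Polynomial.C (eigenvalues A i)) := by
    conv_lhs => rw [(IsAlgClosed.splits A.charpoly).eq_prod_roots_of_monic
      (Matrix.charpoly_monic A), ← eigenvalues_spec A, Multiset.map_map]
    rfl
  suffices h : (a • A).charpoly = ∏ i, (Polynomial.X - Polynomial.C (a * eigenvalues A i)) by
    rw [h, ← Polynomial.roots_multiset_prod_X_sub_C
      (Multiset.map (fun i => a * eigenvalues A i) Finset.univ.val), Multiset.map_map]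
    rfl
  rcases eq_or_ne a 0 with rfl | ha
  · simp [Matrix.charpoly_zero]
  · refine Polynomial.funext fun t => ?_
    have h1 : Matrix.scalar (Fin n) t - a • A = a • (Matrix.scalar (Fin n) (t / a) - A) := by
      ext i j
      simp only [Matrix.sub_apply, Matrix.smul_apply, Matrix.scalar_apply, Matrix.diagonal_apply,
        smul_eq_mul]
      split_ifs
      · field_simp
      · ring
    rw [Matrix.eval_charpoly, h1, Matrix.det_smul, ← Matrix.eval_charpoly, hA,
      Polynomial.eval_prod, Polynomial.eval_prod, Fintype.card, ← Finset.prod_const,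
      ← Finset.prod_mul_distrib]
    refine Finset.prod_congr rfl fun i _ => ?_
    simp only [Polynomial.eval_sub, Polynomial.eval_X, Polynomial.eval_C]
    field_simp

/-- The permutation between the two enumerations only reindexes the rearrangements of `c`; each
factor then contributes one `a`. -/
theorem eval_cPoly_smul {n : ℕ} (A : Matrix (Fin n) (Fin n) ℂ) (c : Fin n → ℝ) (a t : ℂ) :
    (cPoly (a • A) c).eval (a * t) = a ^ (cDeg A c) * (cPoly A c).eval t := by
  obtain ⟨σ, hσ⟩ := exists_perm_eigenvalues_smul A a
  rw [eval_cPoly_eq_prod, eval_cPoly_eq_prod, cDeg_eq_card, ← Finset.prod_const,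
    ← Finset.prod_mul_distrib]
  refine Finset.prod_bij' (fun b _ => b ∘ σ) (fun b _ => b ∘ σ.symm) ?_ ?_ ?_ ?_ ?_
  · intro b hb
    obtain ⟨τ, rfl⟩ := mem_rearrangements.1 hb
    exact mem_rearrangements.2 ⟨σ.trans τ, rfl⟩
  · intro b hb
    obtain ⟨τ, rfl⟩ := mem_rearrangements.1 hb
    exact mem_rearrangements.2 ⟨σ.symm.trans τ, rfl⟩
  · intro b _
    ext i; simp
  · intro b _
    ext i; simp
  · intro b _
    rw [mul_sub, Finset.mul_sum]
    congr 1
    symm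
    refine Fintype.sum_equiv σ _ _ fun i => ?_
    have := congrFun hσ i
    simp only [Function.comp_apply] at this ⊢
    rw [← this]
    ring

open MvPolynomial in
theorem eval_smul_of_isHomogeneous {n : ℕ} {p : MvPolynomial (Fin n) ℂ} {D : ℕ}
    (hp : p.IsHomogeneous D) (a : ℂ) (v : Fin n → ℂ) : eval (a • v) p = a ^ D * eval v p := by
  rw [eval_eq', eval_eq', Finset.mul_sum]
  refine Finset.sum_congr rfl fun d hd => ?_
  have hD : ∑ i, d i = D := by
    rw [← Finsupp.degree_eq_sum, Finsupp.degree_eq_weight_one]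
    exact hp (mem_support_iff.1 hd)
  simp only [Pi.smul_apply, smul_eq_mul, mul_pow]
  rw [Finset.prod_mul_distrib, Finset.prod_pow_eq_pow_sum, hD]
  ring

open MvPolynomial in
theorem eval_smul_eq_sum {n : ℕ} (p : MvPolynomial (Fin n) ℂ) (a : ℂ) (v : Fin n → ℂ) :
    eval (a • v) p = ∑ i ∈ Finset.range (p.totalDegree + 1),
      a ^ i * eval v (homogeneousComponent i p) := by
  conv_lhs => rw [← sum_homogeneousComponent p]
  rw [map_sum]
  exact Finset.sum_congr rfl fun i _ => 
    eval_smul_of_isHomogeneous (homogeneousComponent_isHomogeneous i p) _ _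

open MvPolynomial in
/-- A polynomial whose values scale with weight `D` is a form of degree `D`. -/
theorem isHomogeneous_of_eval_smul {n : ℕ} {p : MvPolynomial (Fin n) ℂ} {D : ℕ}
    (h : ∀ (a : ℂ) (v : Fin n → ℂ), eval (a • v) p = a ^ D * eval v p) : p.IsHomogeneous D := by
  suffices hp : p = homogeneousComponent D p by
    rw [hp]; exact homogeneousComponent_isHomogeneous D p
  refine MvPolynomial.funext fun v => ?_
  -- For fixed `v` both sides are polynomials in the scaling factor, so their coefficients in degree
  -- `D` agree.
  have key : ∑ i ∈ Finset.range (p.totalDegree + 1),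
      Polynomial.C (eval v (homogeneousComponent i p)) * Polynomial.X ^ i =
      Polynomial.C (eval v p) * Polynomial.X ^ D := by
    refine Polynomial.funext fun a => ?_
    have := (eval_smul_eq_sum p a v).symm.trans (h a v)
    simp only [Polynomial.eval_finsetSum, Polynomial.eval_mul, Polynomial.eval_C,
      Polynomial.eval_pow, Polynomial.eval_X]
    rw [mul_comm (eval v p), ← this]
    exact Finset.sum_congr rfl fun i _ => mul_comm _ _
  have hc := congrArg (fun q => Polynomial.coeff q D) key
  simp only [Polynomial.finsetSum_coeff, Polynomial.coeff_C_mul_X_pow, if_true] at hc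
  rw [← hc, Finset.sum_ite_eq]
  split_ifs with hD
  · rfl
  · rw [homogeneousComponent_eq_zero _ _ (by simpa [Nat.lt_succ_iff] using hD)]
    simp

theorem smul_vec_three (a x y t : ℂ) : a • ![x, y, t] = ![a * x, a * y, a * t] := by
  ext i; fin_cases i <;> rfl

theorem pencilPoly_isHomogeneous {n : ℕ} (A : Matrix (Fin n) (Fin n) ℂ) (c : Fin n → ℝ) :
    (pencilPoly A c).IsHomogeneous (cDeg A c) := by
  refine isHomogeneous_of_eval_smul fun a v => ?_
  have hv : v = ![v 0, v 1, v 2] := by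
    ext i; fin_cases i <;> rfl
  rw [hv, smul_vec_three, eval_pencilPoly, eval_pencilPoly, mul_smul, mul_smul, ← smul_add,
    eval_cPoly_smul, cDeg_eq_card, cDeg_eq_card]

open MvPolynomial in
theorem eval_pencilPoly_smul {n : ℕ} (A : Matrix (Fin n) (Fin n) ℂ) (c : Fin n → ℝ)
    (a x y t : ℂ) : eval ![a * x, a * y, a * t] (pencilPoly A c) =
      a ^ cDeg A c * eval ![x, y, t] (pencilPoly A c) := by
  rw [← smul_vec_three, eval_smul_of_isHomogeneous (pencilPoly_isHomogeneous A c)]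

/-! ### Restriction to the points `(1, 0, t)` -/

open MvPolynomial in
theorem eval_pencilPoly_one_zero {n : ℕ} (A : Matrix (Fin n) (Fin n) ℂ) (c : Fin n → ℝ) (t : ℂ) :
    eval ![1, 0, t] (pencilPoly A c) = (cPoly A c).eval t := by
  rw [eval_pencilPoly, one_smul, zero_smul, add_zero]

theorem cPoly_monic {n : ℕ} (A : Matrix (Fin n) (Fin n) ℂ) (c : Fin n → ℝ) : (cPoly A c).Monic :=
  Polynomial.monic_prod_of_monic _ _ fun _ _ => Polynomial.monic_X_sub_C _

open MvPolynomial in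
theorem eval_aeval_one_zero_X (p : MvPolynomial (Fin 3) ℂ) (t : ℂ) :
    (aeval (![1, 0, Polynomial.X] : Fin 3 → Polynomial ℂ) p).eval t = eval ![1, 0, t] p := by
  have h := comp_aeval_apply (![1, 0, Polynomial.X] : Fin 3 → Polynomial ℂ)
    (Polynomial.aeval (R := ℂ) t) p
  rw [Polynomial.coe_aeval_eq_eval] at h
  rw [h, aeval_eq_eval]
  change eval _ p = _
  congr 2
  ext i
  fin_cases i <;> simp

open MvPolynomial in
theorem aeval_pencilPoly {n : ℕ} (A : Matrix (Fin n) (Fin n) ℂ) (c : Fin n → ℝ) :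
    aeval ![1, 0, Polynomial.X] (pencilPoly A c) = cPoly A c := by
  refine Polynomial.funext fun t => ?_
  rw [← eval_pencilPoly_one_zero, eval_aeval_one_zero_X]

theorem pencilPoly_ne_zero {n : ℕ} (A : Matrix (Fin n) (Fin n) ℂ) (c : Fin n → ℝ) :
    pencilPoly A c ≠ 0 := by
  intro h
  have := aeval_pencilPoly A c
  rw [h, map_zero] at this
  exact (cPoly_monic A c).ne_zero this.symm

open MvPolynomial in
/-- Every nontrivial factor of `r(A;c)` vanishes at a point `(1, 0, t)`. -/
theorem exists_eval_eq_zero_of_dvd_pencilPoly {n : ℕ} {A : Matrix (Fin n) (Fin n) ℂ}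
    {c : Fin n → ℝ} {q : MvPolynomial (Fin 3) ℂ} (hq : q ∣ pencilPoly A c) (hu : ¬ IsUnit q) :
    ∃ t : ℂ, eval ![1, 0, t] q = 0 := by
  obtain ⟨w, hw⟩ := hq
  have hP0 := pencilPoly_ne_zero A c
  have hq0 : q ≠ 0 := by rintro rfl; exact hP0 (by simpa using hw)
  have hw0 : w ≠ 0 := by rintro rfl; exact hP0 (by simpa using hw)
  have htd : q.totalDegree + w.totalDegree = cDeg A c := by
    rw [← totalDegree_mul_of_isDomain hq0 hw0, ← hw, (pencilPoly_isHomogeneous A c).totalDegree hP0]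
  have hdeg : ∀ p : MvPolynomial (Fin 3) ℂ,
      (aeval (![1, 0, Polynomial.X] : Fin 3 → Polynomial ℂ) p).natDegree ≤ p.totalDegree := by
    intro p
    have := aeval_natDegree_le (n := 1) p le_rfl (![1, 0, Polynomial.X] : Fin 3 → Polynomial ℂ)
      (by intro i; fin_cases i <;> simp)
    simpa using this
  have hmul := aeval_pencilPoly A c
  rw [hw, map_mul] at hmul
  have hne := (cPoly_monic A c).ne_zero
  rw [← hmul] at hne
  have hnd := congrArg Polynomial.natDegree hmul
  rw [Polynomial.natDegree_mul (left_ne_zero_of_mul hne) (right_ne_zero_of_mul hne)] at hnd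
  have h1 := hdeg q
  have h2 := hdeg w
  have hpos : q.totalDegree ≠ 0 := by
    intro h0
    rw [totalDegree_eq_zero_iff_eq_C] at h0
    apply hu
    rw [h0]
    refine (IsUnit.mk0 _ fun h => hq0 ?_).map C
    rw [h0, h, C_0]
  have : (cPoly A c).natDegree = cDeg A c := rfl
  -- The degrees of `q` and `w`, before and after restriction, both add up to `cDeg A c`, and
  -- restriction cannot raise a degree. Hence `q` keeps its positive degree.
  obtain ⟨t, ht⟩ := IsAlgClosed.exists_root
    (aeval (![1, 0, Polynomial.X] : Fin 3 → Polynomial ℂ) q)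
    (fun h => by
      have h0 := Polynomial.natDegree_eq_of_degree_eq_some (n := 0) h
      omega)
  refine ⟨t, ?_⟩
  rw [← eval_aeval_one_zero_X]
  exact ht

open MvPolynomial in
/-- If `r(A;c)` and `r(B;d)` have too many common zeros, then `A` and `B` share a `c`-value, and
all of them if `r(A;c)` is irreducible. -/
theorem exists_common_cValue_of_common_zeros {n m : ℕ} (A : Matrix (Fin n) (Fin n) ℂ)
    (B : Matrix (Fin m) (Fin m) ℂ) (c : Fin n → ℝ) (d : Fin m → ℝ)
    {ι : Type*} [Fintype ι] (s u : ι → ℂ) (hinj : Function.Injective fun i => (s i, u i))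
    (hsA : ∀ i, eval ![1, s i, u i] (pencilPoly A c) = 0)
    (hsB : ∀ i, eval ![1, s i, u i] (pencilPoly B d) = 0)
    (hcard : cDeg A c * cDeg B d < Fintype.card ι) :
    (∃ z : ℂ, IsCValue A c z ∧ IsCValue B d z) ∧
      (Irreducible (pencilPoly A c) → ∀ z : ℂ, IsCValue A c z → IsCValue B d z) := by
  have hnot : ¬ IsRelPrime (pencilPoly A c) (pencilPoly B d) := fun h =>
    absurd (card_common_zeros_le (pencilPoly_isHomogeneous A c) (pencilPoly_isHomogeneous B d)
      (pencilPoly_ne_zero B d) h s u hinj hsA hsB) (by omega)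
  have hval : ∀ {k : ℕ} (M : Matrix (Fin k) (Fin k) ℂ) (e : Fin k → ℝ)
      (q : MvPolynomial (Fin 3) ℂ) (t : ℂ), q ∣ pencilPoly M e → eval ![1, 0, t] q = 0 →
      IsCValue M e t := by
    rintro k M e q t ⟨w, hw⟩ ht
    rw [← eval_cPoly_eq_zero_iff, ← eval_pencilPoly_one_zero, hw, map_mul, ht, zero_mul]
  constructor
  · obtain ⟨q, hqA, hqB, hqu⟩ : ∃ q, q ∣ pencilPoly A c ∧ q ∣ pencilPoly B d ∧ ¬ IsUnit q := by
      by_contra! h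
      exact hnot fun q h1 h2 => h q h1 h2
    obtain ⟨t, ht⟩ := exists_eval_eq_zero_of_dvd_pencilPoly hqA hqu
    exact ⟨t, hval A c q t hqA ht, hval B d q t hqB ht⟩
  · intro hirr z hz
    have hdvd : pencilPoly A c ∣ pencilPoly B d := by
      by_contra h
      exact hnot (hirr.isRelPrime_iff_not_dvd.2 h)
    refine hval B d _ z hdvd ?_
    rwa [eval_pencilPoly_one_zero, eval_cPoly_eq_zero_iff]

/-! ### Dual coordinates of lines and boundary points of `W(A;c)` -/

/-- `r(A;c)` vanishes at the dual coordinates of the line `Re (ζ v) = ρ`. -/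
def DualVanishes {n : ℕ} (A : Matrix (Fin n) (Fin n) ℂ) (c : Fin n → ℝ) (ζ : ℂ) (ρ : ℝ) : Prop :=
  MvPolynomial.eval ![ζ / 2, starRingEnd ℂ ζ / 2, (ρ : ℂ)] (pencilPoly A c) = 0

theorem DualVanishes.neg {n : ℕ} {A : Matrix (Fin n) (Fin n) ℂ} {c : Fin n → ℝ} {ζ : ℂ} {ρ : ℝ}
    (h : DualVanishes A c ζ ρ) : DualVanishes A c (-ζ) (-ρ) := by
  unfold DualVanishes at h ⊢
  have h1 := eval_pencilPoly_smul A c (-1) (ζ / 2) (starRingEnd ℂ ζ / 2) (ρ : ℂ)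
  rw [h, mul_zero] at h1
  rw [← h1]
  congr 2
  ext i
  fin_cases i <;> simp [neg_div]

theorem isClosed_dualVanishes {n : ℕ} (A : Matrix (Fin n) (Fin n) ℂ) (c : Fin n → ℝ) :
    IsClosed {p : ℂ × ℝ | DualVanishes A c p.1 p.2} := by
  refine isClosed_eq ((MvPolynomial.continuous_eval (pencilPoly A c)).comp ?_) continuous_const
  refine continuous_pi fun i => ?_
  fin_cases i
  · exact continuous_fst.div_const 2
  · exact (Complex.continuous_conj.comp continuous_fst).div_const 2
  · exact Complex.continuous_ofReal.comp continuous_snd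

theorem conj_exp_mul_I (θ : ℝ) :
    starRingEnd ℂ (Complex.exp (θ * Complex.I)) = Complex.exp (-(θ * Complex.I)) := by
  rw [← Complex.exp_conj]; simp

theorem dualVanishes_iff_isCValue {n : ℕ} (A : Matrix (Fin n) (Fin n) ℂ) (c : Fin n → ℝ)
    (θ ρ : ℝ) : DualVanishes A c (Complex.exp (θ * Complex.I)) ρ ↔
      IsCValue (rotHerm A θ) c (ρ : ℂ) := by
  rw [DualVanishes, eval_pencilPoly, ← eval_cPoly_eq_zero_iff, conj_exp_mul_I, rotHerm, smul_add,
    smul_smul, smul_smul, div_mul_eq_mul_div, one_mul, div_mul_eq_mul_div, one_mul]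

/-- The enumeration `f` is arbitrary because both the sorted `eigenvalues₀` and the eigenvalues
indexed by the eigenbasis are needed. -/
theorem dualVanishes_of_roots {n : ℕ} {A : Matrix (Fin n) (Fin n) ℂ} (c : Fin n → ℝ)
    {θ : ℝ} {f : Fin n → ℝ}
    (hf : (rotHerm A θ).charpoly.roots = Multiset.map (fun i => (f i : ℂ)) Finset.univ.val)
    (σ : Equiv.Perm (Fin n)) :
    DualVanishes A c (Complex.exp (θ * Complex.I)) (∑ j, c j * f (σ j)) := by
  rw [dualVanishes_iff_isCValue]
  obtain ⟨τ, hτ⟩ := exists_perm_eigenvalues hf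
  refine ⟨σ.trans τ, ?_⟩
  push_cast
  refine Finset.sum_congr rfl fun j _ => ?_
  rw [show (f (σ j) : ℂ) = _ from congrFun hτ (σ j)]
  rfl

/-- The constraints defining `W(A;c)` come from zeros of `r(A;c)`. -/
theorem dualVanishes_sum_rotEig {n : ℕ} (A : Matrix (Fin n) (Fin n) ℂ) (c : Fin n → ℝ) (θ : ℝ) :
    DualVanishes A c (Complex.exp (θ * Complex.I)) (∑ j, c j * rotEig A θ j) := by
  refine dualVanishes_of_roots c ?_ (Equiv.refl _)
  rw [(rotHerm_isHermitian A θ).roots_charpoly_eq_eigenvalues₀,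
    ← Multiset.map_univ_val_equiv (finCongr (Fintype.card_fin n).symm), Multiset.map_map]
  rfl

theorem isClosed_weightedRange {n : ℕ} (A : Matrix (Fin n) (Fin n) ℂ) (c : Fin n → ℝ) :
    IsClosed (weightedRange A c) := by
  rw [weightedRange, Set.ofPred_forall]
  refine isClosed_iInter fun θ => isClosed_le ?_ continuous_const
  exact Complex.continuous_re.comp (continuous_const.mul continuous_id)

/-- Every boundary point of `W(A;c)` lies on a supporting line given by a zero of `r(A;c)`. -/
theorem exists_dualVanishes_of_mem_frontier {n : ℕ} {A : Matrix (Fin n) (Fin n) ℂ}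
    {c : Fin n → ℝ} {z : ℂ} (hz : z ∈ frontier (weightedRange A c)) :
    ∃ ζ : ℂ, ‖ζ‖ = 1 ∧ DualVanishes A c ζ (ζ * z).re ∧
      ∀ v ∈ weightedRange A c, (ζ * v).re ≤ (ζ * z).re := by
  have hzS : z ∈ weightedRange A c := (isClosed_weightedRange A c).frontier_subset hz
  rw [frontier_eq_closure_inter_closure] at hz
  -- A point outside the range within `1/(k+1)` of `z` violates some constraint, whose offset then
  -- exceeds its value at `z` by at most `1/(k+1)`.
  have hseq : ∀ k : ℕ, ∃ p : ℂ × ℝ, ‖p.1‖ = 1 ∧ DualVanishes A c p.1 p.2 ∧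
      (∀ v ∈ weightedRange A c, (p.1 * v).re ≤ p.2) ∧ p.2 ≤ (p.1 * z).re + 1 / ((k : ℝ) + 1) := by
    intro k
    obtain ⟨v, hv, hvz⟩ := Metric.mem_closure_iff.1 hz.2 (1 / ((k : ℝ) + 1)) (by positivity)
    simp only [weightedRange, Set.mem_compl_iff, Set.mem_ofPred_eq, not_forall, not_le] at hv
    obtain ⟨θ, hθ⟩ := hv
    refine ⟨(Complex.exp (θ * Complex.I), ∑ j, c j * rotEig A θ j),
      Complex.norm_exp_ofReal_mul_I θ, dualVanishes_sum_rotEig A c θ, fun v hv => hv θ, ?_⟩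
    have h1 : (Complex.exp (θ * Complex.I) * v).re - (Complex.exp (θ * Complex.I) * z).re ≤
        dist z v := by
      rw [← Complex.sub_re, ← mul_sub, dist_comm, dist_eq_norm]
      refine (Complex.re_le_norm _).trans ?_
      rw [norm_mul, Complex.norm_exp_ofReal_mul_I, one_mul]
    dsimp only
    linarith
  choose p hp1 hp2 hp3 hp4 using hseq
  -- Unit normals subconverge by compactness; the offsets are squeezed to `Re (ζ z)`.
  obtain ⟨ζ, hζ, φ, hφ, hlim⟩ := (isCompact_sphere (0 : ℂ) 1).tendsto_subseq
    (x := fun k => (p k).1) (fun k => by simpa using hp1 k)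
  have hre : ∀ v, Filter.Tendsto (fun k => ((p (φ k)).1 * v).re) Filter.atTop (𝓝 (ζ * v).re) :=
    fun v => (Complex.continuous_re.tendsto _).comp (hlim.mul_const v)
  have hρ : Filter.Tendsto (fun k => (p (φ k)).2) Filter.atTop (𝓝 (ζ * z).re) := by
    refine tendsto_of_tendsto_of_tendsto_of_le_of_le (hre z) (?_ : Filter.Tendsto
      (fun k => ((p (φ k)).1 * z).re + 1 / ((φ k : ℝ) + 1)) Filter.atTop (𝓝 (ζ * z).re))
      (fun k => hp3 _ z hzS) (fun k => hp4 _)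
    simpa using (hre z).add ((tendsto_one_div_add_atTop_nhds_zero_nat (𝕜 := ℝ)).comp
      hφ.tendsto_atTop)
  refine ⟨ζ, by simpa using hζ, ?_, fun v hv => ?_⟩
  · have hpair : Filter.Tendsto (fun k => p (φ k)) Filter.atTop (𝓝 (ζ, (ζ * z).re)) :=
      hlim.prodMk_nhds hρ
    have hmem : ∀ᶠ k in Filter.atTop, p (φ k) ∈ {q : ℂ × ℝ | DualVanishes A c q.1 q.2} :=
      Filter.Eventually.of_forall fun k => hp2 (φ k)
    have hlimit := (isClosed_dualVanishes A c).mem_of_tendsto hpair hmem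
    rwa [Set.mem_ofPred_eq] at hlimit
  · exact le_of_tendsto_of_tendsto' (hre v) hρ fun k => hp3 _ v hv

/-- The supporting direction at a differentiable boundary point is unique up to sign. -/
theorem IsDifferentiableBoundaryPoint.eq_or_eq_neg {S : Set ℂ} (hS : IsClosed S) {z ζ ζ' : ℂ}
    (hz : IsDifferentiableBoundaryPoint S z) (h1 : ‖ζ‖ = 1) (h1' : ‖ζ'‖ = 1)
    (hζ : ∀ v ∈ S, (ζ * v).re ≤ (ζ * z).re) (hζ' : ∀ v ∈ S, (ζ' * v).re ≤ (ζ' * z).re) :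
    ζ = ζ' ∨ ζ = -ζ' := by
  obtain ⟨γ, w, h0, hd, hw, hmap⟩ := hz
  have hmem : ∀ᶠ t in 𝓝 (0 : ℝ), γ t ∈ S := by
    have : frontier S ∈ Filter.map γ (𝓝 0) := by rw [hmap]; exact self_mem_nhdsWithin
    exact Filter.mem_of_superset this fun t ht => hS.frontier_subset ht
  -- `Re (η γ(t))` has a local maximum at `0`, so the tangent `w` satisfies `Re (η w) = 0`. Thus `ζ
  -- w` and `ζ' w` are imaginary of equal modulus.
  have hre : ∀ η : ℂ, (∀ v ∈ S, (η * v).re ≤ (η * z).re) → (η * w).re = 0 := by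
    intro η hη
    have hder : HasDerivAt (fun t => (η * γ t).re) (η * w).re 0 :=
      Complex.reCLM.hasFDerivAt.comp_hasDerivAt (0 : ℝ) (hd.const_mul η)
    refine IsLocalMax.hasDerivAt_eq_zero ?_ hder
    filter_upwards [hmem] with t ht
    rw [h0]
    exact hη _ ht
  have e1 := hre ζ hζ
  have e2 := hre ζ' hζ'
  have hn : ‖ζ * w‖ ^ 2 = ‖ζ' * w‖ ^ 2 := by rw [norm_mul, norm_mul, h1, h1']
  rw [Complex.sq_norm, Complex.sq_norm, Complex.normSq_apply, Complex.normSq_apply, e1, e2] at hn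
  have hsq : (ζ * w).im ^ 2 = (ζ' * w).im ^ 2 := by linarith
  rcases sq_eq_sq_iff_eq_or_eq_neg.1 hsq with h | h
  · left
    exact mul_right_cancel₀ hw (Complex.ext (by rw [e1, e2]) h)
  · right
    refine mul_right_cancel₀ hw (Complex.ext ?_ ?_)
    · rw [neg_mul, Complex.neg_re, e1, e2, neg_zero]
    · rw [neg_mul, Complex.neg_im, h]

/-- A real line determines its unit normal and offset up to a common sign. -/
theorem line_eq_imp {ζ ζ' : ℂ} {ρ ρ' : ℝ} (h1 : ‖ζ‖ = 1) (h1' : ‖ζ'‖ = 1)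
    (h : {v : ℂ | (ζ * v).re = ρ} = {v : ℂ | (ζ' * v).re = ρ'}) :
    (ζ' = ζ ∧ ρ' = ρ) ∨ (ζ' = -ζ ∧ ρ' = -ρ) := by
  have hc : ζ * starRingEnd ℂ ζ = 1 := by
    rw [Complex.mul_conj, Complex.normSq_eq_norm_sq, h1]; simp
  set η := ζ' * starRingEnd ℂ ζ with hη
  have hη1 : ‖η‖ = 1 := by rw [hη, norm_mul, RCLike.norm_conj, h1, h1', one_mul]
  have hζ' : ζ' = η * ζ := by rw [hη]; linear_combination -ζ' * hc
  -- The points `ζ̄ (ρ + s i)` lie on the first line; comparing `s = 0` and `s = 1` forces `Im η =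
  -- 0`.
  have key : ∀ s : ℝ, (η * (ρ + s * Complex.I)).re = ρ' := by
    intro s
    have hm : starRingEnd ℂ ζ * (ρ + s * Complex.I) ∈ {v : ℂ | (ζ * v).re = ρ} := by
      rw [Set.mem_ofPred_eq, ← mul_assoc, hc]; simp
    rw [h, Set.mem_ofPred_eq, ← mul_assoc] at hm
    exact hm
  have k0 := key 0
  have k1 := key 1
  simp at k0 k1
  have him : η.im = 0 := by linarith
  have hsq : η.re ^ 2 = 1 := by
    have h2 : ‖η‖ ^ 2 = 1 := by rw [hη1]; norm_num
    rw [Complex.sq_norm, Complex.normSq_apply, him] at h2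
    linarith
  rcases sq_eq_one_iff.1 hsq with h | h
  · left
    have : η = 1 := Complex.ext h him
    exact ⟨by rw [hζ', this, one_mul], by rw [← k0, h, one_mul]⟩
  · right
    have : η = -1 := Complex.ext h (by simpa using him)
    exact ⟨by rw [hζ', this, neg_one_mul], by rw [← k0, h, neg_one_mul]⟩

/-! ### Supporting lines of the `c`-numerical range -/

theorem re_exp_mul_quadratic {n : ℕ} (A : Matrix (Fin n) (Fin n) ℂ) (θ : ℝ) (x : Fin n → ℂ) :
    (Complex.exp (θ * Complex.I) * (star x ⬝ᵥ A.mulVec x)).re =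
      (star x ⬝ᵥ (rotHerm A θ).mulVec x).re := by
  have h : star x ⬝ᵥ A.conjTranspose.mulVec x = starRingEnd ℂ (star x ⬝ᵥ A.mulVec x) := by
    rw [starRingEnd_apply, Matrix.star_dotProduct, Matrix.star_mulVec, Matrix.dotProduct_mulVec,
      Matrix.conjTranspose_conjTranspose]
  rw [rotHerm, Matrix.smul_mulVec, Matrix.add_mulVec, Matrix.smul_mulVec, Matrix.smul_mulVec,
    dotProduct_smul, dotProduct_add, dotProduct_smul, dotProduct_smul, h, ← conj_exp_mul_I]
  simp
  ring

/-- The quadratic form of a Hermitian matrix in an orthonormal eigenbasis. -/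
theorem re_quadratic_eq_sum {n : ℕ} {H : Matrix (Fin n) (Fin n) ℂ} (hH : H.IsHermitian)
    (x : EuclideanSpace ℂ (Fin n)) :
    (star x.ofLp ⬝ᵥ H.mulVec x.ofLp).re =
      ∑ k, ‖inner ℂ (hH.eigenvectorBasis k) x‖ ^ 2 * hH.eigenvalues k := by
  have hu : ∀ k, inner ℂ (hH.eigenvectorBasis k) (WithLp.toLp 2 (H.mulVec x.ofLp)) =
      (hH.eigenvalues k : ℂ) * inner ℂ (hH.eigenvectorBasis k) x := by
    intro k
    rw [EuclideanSpace.inner_eq_star_dotProduct, EuclideanSpace.inner_eq_star_dotProduct,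
      dotProduct_comm, dotProduct_comm x.ofLp, Matrix.dotProduct_mulVec]
    rw [show Matrix.vecMul (star (hH.eigenvectorBasis k).ofLp) H =
      star (H.mulVec (hH.eigenvectorBasis k).ofLp) by rw [Matrix.star_mulVec, hH.eq],
      hH.mulVec_eigenvectorBasis]
    simp [smul_dotProduct]
  have h := hH.eigenvectorBasis.sum_inner_mul_inner x (WithLp.toLp 2 (H.mulVec x.ofLp))
  rw [EuclideanSpace.inner_eq_star_dotProduct x, dotProduct_comm] at h
  rw [← h, Complex.re_sum]
  refine Finset.sum_congr rfl fun k _ => ?_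
  rw [hu, mul_left_comm, Complex.re_ofReal_mul, ← inner_conj_symm x, Complex.conj_mul', mul_comm,
    ← Complex.ofReal_pow, Complex.ofReal_re]

/-- The squared moduli of the coordinates of the `x_j` in an eigenbasis of `H_θ(A)` form a doubly
stochastic matrix. By Birkhoff, `ρ` is a convex combination of permuted sums, each attained by a
permuted eigenbasis and so at most `ρ`; hence some sum equals `ρ`. -/
theorem exists_perm_of_isSupporting_cNumericalRange {n : ℕ} {A : Matrix (Fin n) (Fin n) ℂ}
    {c : Fin n → ℝ} {θ ρ : ℝ}
    (hle : ∀ v ∈ cNumericalRange A c, (Complex.exp (θ * Complex.I) * v).re ≤ ρ)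
    {z : ℂ} (hz : z ∈ cNumericalRange A c) (hzρ : (Complex.exp (θ * Complex.I) * z).re = ρ) :
    ∃ σ : Equiv.Perm (Fin n),
      ρ = ∑ j, c j * (rotHerm_isHermitian A θ).eigenvalues (σ j) := by
  set hH := rotHerm_isHermitian A θ with hH_def
  have hval : ∀ x : Fin n → EuclideanSpace ℂ (Fin n),
      (Complex.exp (θ * Complex.I) *
        ∑ j, (c j : ℂ) * (star (x j).ofLp ⬝ᵥ A.mulVec (x j).ofLp)).re =
      ∑ j, c j * ∑ k, ‖inner ℂ (hH.eigenvectorBasis k) (x j)‖ ^ 2 * hH.eigenvalues k := by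
    intro x
    rw [Finset.mul_sum, Complex.re_sum]
    refine Finset.sum_congr rfl fun j _ => ?_
    rw [← re_quadratic_eq_sum hH, ← re_exp_mul_quadratic, mul_left_comm, Complex.re_ofReal_mul]
  have hperm : ∀ σ : Equiv.Perm (Fin n), ∑ j, c j * hH.eigenvalues (σ j) ≤ ρ := by
    intro σ
    have hu := hH.eigenvectorBasis.orthonormal
    have := hle _ ⟨fun j => hH.eigenvectorBasis (σ j), hu.comp σ σ.injective, rfl⟩
    rw [hval] at this
    refine le_trans (le_of_eq ?_) this
    refine Finset.sum_congr rfl fun j _ => ?_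
    congr 1
    rw [Finset.sum_eq_single (σ j)]
    · simp
    · intro k _ hk
      rw [hu.2 hk]
      simp
    · simp
  obtain ⟨x, hx, rfl⟩ := hz
  rw [hval] at hzρ
  let M : Matrix (Fin n) (Fin n) ℝ := Matrix.of fun j k =>
    ‖inner ℂ (hH.eigenvectorBasis k) (x j)‖ ^ 2
  have hM : M ∈ doublyStochastic ℝ (Fin n) := by
    rw [mem_doublyStochastic_iff_sum]
    refine ⟨fun j k => by simp only [M, Matrix.of_apply]; positivity, fun j => ?_, fun k => ?_⟩
    · simp only [M, Matrix.of_apply]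
      rw [OrthonormalBasis.sum_sq_norm_inner_right, hx.1 j, one_pow]
    -- The `n` orthonormal vectors already form a basis, so Parseval gives the column sums.
    · obtain ⟨b, hb⟩ := Orthonormal.exists_orthonormalBasis_extension_of_card_eq
        (𝕜 := ℂ) (E := EuclideanSpace ℂ (Fin n)) (ι := Fin n) (by simp) (v := x) (s := Set.univ)
        (hx.comp _ Subtype.val_injective)
      simp only [M, Matrix.of_apply, ← hb _ (Set.mem_univ _)]
      rw [OrthonormalBasis.sum_sq_norm_inner_left, hH.eigenvectorBasis.orthonormal.1 k, one_pow]
  obtain ⟨w, hw0, hw1, hwM⟩ := exists_eq_sum_perm_of_mem_doublyStochastic hM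
  have hρ : ρ = ∑ σ, w σ * ∑ j, c j * hH.eigenvalues (σ j) := by
    have hMk : ∀ j, ∑ k, M j k * hH.eigenvalues k = ∑ σ, w σ * hH.eigenvalues (σ j) := by
      intro j
      rw [← hwM]
      simp only [Matrix.sum_apply, Matrix.smul_apply, smul_eq_mul, Finset.sum_mul]
      rw [Finset.sum_comm]
      refine Finset.sum_congr rfl fun σ _ => ?_
      simp [Equiv.Perm.permMatrix, PEquiv.toMatrix_apply]
    rw [← hzρ]
    change ∑ j, c j * ∑ k, M j k * hH.eigenvalues k = _
    simp only [hMk, Finset.mul_sum]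
    rw [Finset.sum_comm]
    refine Finset.sum_congr rfl fun σ _ => Finset.sum_congr rfl fun j _ => by ring
  by_contra! hne
  have hz : ∑ σ, w σ * (ρ - ∑ j, c j * hH.eigenvalues (σ j)) = 0 := by
    simp only [mul_sub, Finset.sum_sub_distrib]
    rw [← Finset.sum_mul, hw1, one_mul, ← hρ, sub_self]
  rw [Finset.sum_eq_zero_iff_of_nonneg fun σ _ =>
    mul_nonneg (hw0 σ) (sub_nonneg.2 (hperm σ))] at hz
  have hw : ∀ σ, w σ = 0 := fun σ =>
    (mul_eq_zero.1 (hz σ (Finset.mem_univ σ))).resolve_right (sub_ne_zero.2 (hne σ))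
  simp [hw] at hw1

/-! ### From common supporting lines to common zeros -/

/-- Supporting lines of `W(A;c)` are zeros of `r(A;c)`. -/
theorem IsSupportingLine.exists_dualVanishes {n : ℕ} {A : Matrix (Fin n) (Fin n) ℂ}
    {c : Fin n → ℝ} {L : Set ℂ} (hL : IsSupportingLine (weightedRange A c) L)
    (h : weightedRange A c = cNumericalRange A c ∨ TouchesDifferentiably (weightedRange A c) L) :
    ∃ (ζ : ℂ) (ρ : ℝ), ‖ζ‖ = 1 ∧ L = {v | (ζ * v).re = ρ} ∧ DualVanishes A c ζ ρ := by
  obtain ⟨θ, ρ, rfl, hle, z, hzS, hzL⟩ := hL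
  refine ⟨Complex.exp (θ * Complex.I), ρ, Complex.norm_exp_ofReal_mul_I θ, rfl, ?_⟩
  rcases h with h | ⟨z', ⟨hz'L, hz'⟩, hdiff⟩
  · rw [h] at hle hzS
    obtain ⟨σ, hσ⟩ := exists_perm_of_isSupporting_cNumericalRange hle hzS hzL
    rw [hσ]
    exact dualVanishes_of_roots c (rotHerm_isHermitian A θ).roots_charpoly_eq_eigenvalues σ
  · obtain ⟨ζ, hζ1, hζ, hζle⟩ := exists_dualVanishes_of_mem_frontier hz'
    have hz'ρ : (Complex.exp (θ * Complex.I) * z').re = ρ := hz'L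
    rw [← hz'ρ] at hle ⊢
    -- Both the limiting constraint line and `L` support the range at `z'`, so their normals agree
    -- up to sign.
    rcases hdiff.eq_or_eq_neg (isClosed_weightedRange A c) hζ1 (Complex.norm_exp_ofReal_mul_I θ)
      hζle hle with rfl | rfl
    · exact hζ
    · simpa using hζ.neg

/-- The normalised dual point of a line is a zero of `r(A;c)`. -/
theorem DualVanishes.eval_eq_zero {n : ℕ} {A : Matrix (Fin n) (Fin n) ℂ} {c : Fin n → ℝ}
    {ζ : ℂ} {ρ : ℝ} (h : DualVanishes A c ζ ρ) (hζ : ‖ζ‖ = 1) :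
    MvPolynomial.eval ![1, starRingEnd ℂ ζ / ζ, 2 * ρ / ζ] (pencilPoly A c) = 0 := by
  have hζ0 : ζ ≠ 0 := by rintro rfl; simp at hζ
  -- Scaling by `2/ζ` moves the dual point into the chart `x = 1`.
  have h1 := eval_pencilPoly_smul A c (2 / ζ) (ζ / 2) (starRingEnd ℂ ζ / 2) (ρ : ℂ)
  rw [show MvPolynomial.eval _ _ = _ from h, mul_zero] at h1
  rw [← h1]
  congr 2
  ext i
  fin_cases i
  · simp [hζ0]
  · change starRingEnd ℂ ζ / ζ = 2 / ζ * (starRingEnd ℂ ζ / 2)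
    field_simp
  · simp [div_mul_eq_mul_div]

/-- For a unit `ζ`, `ζ̄/ζ = ζ⁻²` fixes `ζ` up to sign, and `2ρ/ζ` then fixes `ρ` with the same sign.
Hence distinct lines yield distinct points. -/
theorem line_eq_of_dual_point_eq {ζ ζ' : ℂ} {ρ ρ' : ℝ} (h1 : ‖ζ‖ = 1) (h1' : ‖ζ'‖ = 1)
    (hs : starRingEnd ℂ ζ / ζ = starRingEnd ℂ ζ' / ζ') (hu : 2 * (ρ : ℂ) / ζ = 2 * ρ' / ζ') :
    {v : ℂ | (ζ * v).re = ρ} = {v : ℂ | (ζ' * v).re = ρ'} := by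
  have hζ0 : ζ ≠ 0 := by rintro rfl; simp at h1
  have hζ0' : ζ' ≠ 0 := by rintro rfl; simp at h1'
  have hc : ζ * starRingEnd ℂ ζ = 1 := by
    rw [Complex.mul_conj, Complex.normSq_eq_norm_sq, h1]; simp
  have hc' : ζ' * starRingEnd ℂ ζ' = 1 := by
    rw [Complex.mul_conj, Complex.normSq_eq_norm_sq, h1']; simp
  rw [div_eq_div_iff hζ0 hζ0'] at hs hu
  have hsq : ζ ^ 2 = ζ' ^ 2 := by
    linear_combination (-ζ ^ 2) * hc' + ζ' ^ 2 * hc - ζ * ζ' * hs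
  rcases sq_eq_sq_iff_eq_or_eq_neg.1 hsq with rfl | rfl
  · have : ρ = ρ' := by
      have := mul_right_cancel₀ hζ0 hu
      have := mul_left_cancel₀ two_ne_zero this
      exact_mod_cast this
    rw [this]
  · have : ρ = -ρ' := by
      have h2 : 2 * (ρ : ℂ) * ζ' = 2 * (-ρ' : ℂ) * ζ' := by rw [hu]; ring
      have := mul_right_cancel₀ hζ0' h2
      have := mul_left_cancel₀ two_ne_zero this
      exact_mod_cast this
    ext v
    rw [Set.mem_ofPred_eq, Set.mem_ofPred_eq, this, neg_mul, Complex.neg_re, neg_inj]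

end WeightedRange

theorem mainTheorem3 (n m : ℕ)
    (A : Matrix (Fin n) (Fin n) ℂ) (B : Matrix (Fin m) (Fin m) ℂ)
    (c : Fin n → ℝ) (d : Fin m → ℝ)
    (hlines : ((cDeg A c * cDeg B d : ℕ) : ℕ∞) <
      (commonSupportingLines (weightedRange A c) (weightedRange B d)).encard)
    (hA : weightedRange A c = cNumericalRange A c ∨
      ∀ L ∈ commonSupportingLines (weightedRange A c) (weightedRange B d),
        TouchesDifferentiably (weightedRange A c) L)
    (hB : weightedRange B d = cNumericalRange B d ∨
      ∀ L ∈ commonSupportingLines (weightedRange A c) (weightedRange B d),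
        TouchesDifferentiably (weightedRange B d) L) :
    (∃ z : ℂ, IsCValue A c z ∧ IsCValue B d z) ∧
      (Irreducible (pencilPoly A c) → ∀ z : ℂ, IsCValue A c z → IsCValue B d z) := by
  have key : ∀ L ∈ commonSupportingLines (weightedRange A c) (weightedRange B d),
      ∃ (ζ : ℂ) (ρ : ℝ), ‖ζ‖ = 1 ∧ L = {v | (ζ * v).re = ρ} ∧
        DualVanishes A c ζ ρ ∧ DualVanishes B d ζ ρ := by
    intro L hL
    obtain ⟨ζ, ρ, h1, hL1, hv⟩ := hL.1.exists_dualVanishes (hA.imp_right fun h => h L hL)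
    obtain ⟨ζ', ρ', h1', hL1', hv'⟩ := hL.2.exists_dualVanishes (hB.imp_right fun h => h L hL)
    refine ⟨ζ, ρ, h1, hL1, hv, ?_⟩
    rcases line_eq_imp h1' h1 (hL1'.symm.trans hL1) with ⟨rfl, rfl⟩ | ⟨rfl, rfl⟩
    · exact hv'
    · exact hv'.neg
  -- There may be infinitely many common lines; one more than the Bézout bound suffices.
  obtain ⟨T, hT, hTcard⟩ := Set.exists_subset_encard_eq (Order.add_one_le_of_lt hlines)
  have hfin : T.Finite := Set.finite_of_encard_eq_coe
    (hTcard.trans (by push_cast; rfl : _ = ((cDeg A c * cDeg B d + 1 : ℕ) : ℕ∞)))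
  have := hfin.fintype
  have hcard : Fintype.card T = cDeg A c * cDeg B d + 1 := by
    rw [← Nat.card_eq_fintype_card, Nat.card_coe_set_eq, Set.ncard, hTcard]
    rfl
  choose! ζ ρ h1 hL hvA hvB using key
  refine exists_common_cValue_of_common_zeros A B c d
    (fun L : T => starRingEnd ℂ (ζ L) / ζ L) (fun L : T => 2 * ρ L / ζ L) ?_
    (fun L => (hvA L (hT L.2)).eval_eq_zero (h1 L (hT L.2)))
    (fun L => (hvB L (hT L.2)).eval_eq_zero (h1 L (hT L.2))) (by omega)
  intro L L' hLL
  rw [Prod.mk.injEq] at hLL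
  refine Subtype.ext ?_
  rw [hL L (hT L.2), hL L' (hT L'.2)]
  exact line_eq_of_dual_point_eq (h1 L (hT L.2)) (h1 L' (hT L'.2)) hLL.1 hLL.2
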